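/- Let $k \ge 1$ be a fixed integer. An involution of $[n]=\{1,\dots,n\}$ is a permutation all of whose cycles have length $1$ or $2$ (so the identity is an involution). For each $n$, let $\sigma$ and $\tau$ be independent random involutions of $[n]$, each uniformly distributed on the set of all involutions of $[n]$, and let $X_n^{(k)}$ be the number of cycles of length $k$ of the permutation $\tau\circ\sigma$ (cycles of length $1$ being fixed points). Then, as $n\to\infty$, $X_n^{(k)}$ converges in distribution to $A_k + 2B_k$, where $A_k$ and $B_k$ are independent, $A_k$ is Poisson with mean $1$, and $B_k$ is Poisson with mean $1/(2k)$. -/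

import Mathlib

/-- The involutions of `[n]`: permutations `σ` of an `n`-element set with `σ ∘ σ = id`, that is, with
all cycles of length `1` or `2`. -/
def Involution (n : ℕ) : Type := {σ : Equiv.Perm (Fin n) // σ * σ = 1}

namespace Involution

instance (n : ℕ) : Fintype (Involution n) :=
  inferInstanceAs (Fintype {σ : Equiv.Perm (Fin n) // σ * σ = 1})

instance (n : ℕ) : Nonempty (Involution n) := ⟨⟨1, one_mul 1⟩⟩

instance (n : ℕ) : MeasurableSpace (Involution n) := ⊤

instance (n : ℕ) : DiscreteMeasurableSpace (Involution n) := ⟨fun _ => trivial⟩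

/-- The permutation underlying an involution. -/
def toPerm {n : ℕ} (σ : Involution n) : Equiv.Perm (Fin n) := σ.1

/-- The uniform probability measure on the involutions of `[n]`. -/
noncomputable def uniform (n : ℕ) : MeasureTheory.Measure (Involution n) :=
  (PMF.uniformOfFintype (Involution n)).toMeasure

end Involution

/-- The number of cycles of length `k` of a permutation of `[n]`, fixed points being the cycles of
length `1`: the multiplicity of `k` in the full cycle type of the permutation. -/
def numCycles {n : ℕ} (k : ℕ) (π : Equiv.Perm (Fin n)) : ℕ :=
  π.partition.parts.count k

/-! Write `π = τ * σ`. Since `σ` conjugates `π` to its inverse, it permutes the `k`-cycles of `π`.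
It either preserves such a cycle, acting on it as a reflection `i ↦ c - i` of `ZMod k`, or exchanges
it with another `k`-cycle. Preserved cycles produce `A`, exchanged pairs produce `2B`.

A point on a `k`-cycle thus amounts to an equivariant embedding of a `k`-gon (for one of `k` values
of `c`) or of the regular dihedral set with `2k` points. Deleting its image leaves an arbitrary pair
of involutions on `n - k` or `n - 2k` points, which gives the size-bias identity
`sum_pairCycles_mul`.

Let `F_n(u)` be the sum of `u ^ X` over all pairs, divided by `n!`, and let `w_n = F_n(1) = t_n² /
n!`, where `t_n` counts the involutions. The identity becomes `F_n' = F_{n-k} + (u/k) F_{n-2k}`,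
whose solution is the sum over `a, b` of `(u-1)^a/a! * ((u²-1)/(2k))^b/b! * w_{n-ka-2kb}`
(`cyclePoly_eq_cycleExpansion`).

The recurrence for `t_n` shows that `w` is increasing with `w_{n-j}/w_n → 1`. Dominated convergence
then gives `F_n(u)/w_n → exp(u-1) * exp((u²-1)/(2k))`, the generating function of `A + 2B`; taking
`u = exp(it)` gives convergence of characteristic functions. -/

open Equiv

/-! ### Counting cycles through the points on them -/

/-- The point `v` lies on a cycle of length `k` of `π`. -/
def HasExactPeriod {α : Type*} (k : ℕ) (π : Perm α) (v : α) : Prop :=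
  ∀ m : ℤ, (π ^ m) v = v ↔ (k : ℤ) ∣ m

theorem hasExactPeriod_one_iff {α : Type*} (π : Perm α) (v : α) :
    HasExactPeriod 1 π v ↔ π v = v := by
  refine ⟨fun h => by simpa using (h 1).2 (by simp), fun h m => ?_⟩
  simpa using Equiv.Perm.zpow_apply_eq_self_of_apply_eq_self h m

theorem hasExactPeriod_iff_card_support_cycleOf {α : Type*} [Fintype α] [DecidableEq α] {k : ℕ}
    (hk : 2 ≤ k) (π : Perm α) (v : α) :
    HasExactPeriod k π v ↔ (π.cycleOf v).support.card = k := by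
  -- A power of a cycle that fixes one point of its support is trivial, so the stabiliser of `v` is
  -- generated by the order of its cycle.
  have key : ∀ m : ℤ, (π ^ m) v = v ↔ (orderOf (π.cycleOf v) : ℤ) ∣ m := by
    intro m
    rw [orderOf_dvd_iff_zpow_eq_one, ← Perm.cycleOf_zpow_apply_self]
    refine ⟨fun h => ?_, fun h => by rw [h]; rfl⟩
    by_cases hv : π v = v
    · rw [(Perm.cycleOf_eq_one_iff π).2 hv, one_zpow]
    · have hc := Perm.isCycle_cycleOf π hv
      have hv' : π.cycleOf v v ≠ v := by simpa using hv
      obtain ⟨n, rfl | rfl⟩ := m.eq_nat_or_neg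
      · rw [zpow_natCast] at h ⊢
        exact hc.pow_eq_one_iff.2 ⟨v, hv', h⟩
      · rw [zpow_neg, zpow_natCast] at h ⊢
        rw [inv_eq_one]
        exact hc.pow_eq_one_iff.2 ⟨v, hv', (Perm.inv_eq_iff_eq.1 h).symm⟩
  have h1 : HasExactPeriod k π v ↔ orderOf (π.cycleOf v) = k := by
    constructor
    · intro h
      apply Nat.dvd_antisymm
      · exact_mod_cast (key k).1 ((h k).2 dvd_rfl)
      · exact_mod_cast (h _).1 ((key _).2 dvd_rfl)
    · rintro rfl
      exact key
  rw [h1]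
  by_cases hv : π v = v
  · rw [(Perm.cycleOf_eq_one_iff π).2 hv]
    simp
    omega
  · rw [(Perm.isCycle_cycleOf π hv).orderOf]

/-- Supports of distinct cycles are disjoint, so each cycle contributes exactly `k` points. The case
`k = 1` is separate because `cycleType` omits fixed points. -/
theorem mul_numCycles {n k : ℕ} (hk : 1 ≤ k) (π : Perm (Fin n)) :
    k * numCycles k π = Nat.card {v // HasExactPeriod k π v} := by
  classical
  rw [Nat.card_eq_fintype_card, Fintype.card_subtype, numCycles, Perm.parts_partition,
    Multiset.count_add]
  rcases hk.eq_or_lt with rfl | hk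
  · have h0 : π.cycleType.count 1 = 0 :=
      Multiset.count_eq_zero.2 fun h => absurd (Perm.one_lt_of_mem_cycleType h) (by simp)
    rw [h0, Multiset.count_replicate_self, zero_add, one_mul, ← Finset.card_compl]
    congr 1
    ext v
    simp [hasExactPeriod_one_iff]
  · rw [Multiset.count_replicate, if_neg (by omega), add_zero, Perm.cycleType_def,
      Multiset.count_map]
    have h1 : (Finset.univ.filter fun v => HasExactPeriod k π v) =
        (π.cycleFactorsFinset.filter fun c => k = c.support.card).biUnion Perm.support := by
      ext v
      simp only [Finset.mem_filter, Finset.mem_univ, true_and, Finset.mem_biUnion]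
      rw [hasExactPeriod_iff_card_support_cycleOf hk]
      constructor
      · intro h
        have hv : v ∈ π.support := by
          rw [Perm.mem_support]
          intro h'
          rw [(Perm.cycleOf_eq_one_iff π).2 h'] at h
          simp at h
          omega
        exact ⟨π.cycleOf v, ⟨Perm.cycleOf_mem_cycleFactorsFinset_iff.2 hv, h.symm⟩,
          Perm.mem_support_cycleOf_iff.2 ⟨Perm.SameCycle.refl _ _, hv⟩⟩
      · rintro ⟨c, ⟨hc, hck⟩, hv⟩
        rw [← (Perm.cycle_is_cycleOf hv hc), hck]
    rw [h1, Finset.card_biUnion]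
    · rw [Finset.sum_congr rfl (g := fun _ => k)
        (fun c hc => ((Finset.mem_filter.1 hc).2).symm), Finset.sum_const, smul_eq_mul, mul_comm]
      rfl
    · intro c hc d hd hcd
      exact (π.cycleFactorsFinset_pairwise_disjoint (Finset.mem_filter.1 hc).1
        (Finset.mem_filter.1 hd).1 hcd).disjoint_support

theorem hasExactPeriod_permCongr {α β : Type*} (ε : β ≃ α) (k : ℕ) (π : Perm β) (v : β) :
    HasExactPeriod k (ε.permCongr π) (ε v) ↔ HasExactPeriod k π v := by
  have h : ∀ m : ℤ, (ε.permCongr π) ^ m = ε.permCongr (π ^ m) := fun m =>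
    (map_zpow ε.permCongrHom π m).symm
  simp [HasExactPeriod, h, Equiv.permCongr_apply]

theorem sumCongr_zpow {β γ : Type*} (s : Perm β) (t : Perm γ) (m : ℤ) :
    (Perm.sumCongr s t) ^ m = Perm.sumCongr (s ^ m) (t ^ m) :=
  (map_zpow (Perm.sumCongrHom β γ) (s, t) m).symm

theorem card_hasExactPeriod_permCongr_sumCongr {α β γ : Type*} [Finite β] [Finite γ]
    (ε : β ⊕ γ ≃ α) (k : ℕ) (s : Perm β) (t : Perm γ) :
    Nat.card {v // HasExactPeriod k (ε.permCongr (Perm.sumCongr s t)) v} =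
      Nat.card {v // HasExactPeriod k s v} + Nat.card {v // HasExactPeriod k t v} := by
  rw [← Nat.card_sum]
  refine (Nat.card_congr ?_).symm
  refine Equiv.trans ?_ (ε.subtypeEquiv (p := fun v => HasExactPeriod k (Perm.sumCongr s t) v)
    fun v => (hasExactPeriod_permCongr ε k _ v).symm)
  refine Equiv.trans ?_ Equiv.subtypeSum.symm
  refine Equiv.sumCongr (Equiv.subtypeEquivRight fun v => ?_) (Equiv.subtypeEquivRight fun v => ?_)
  · simp [HasExactPeriod, sumCongr_zpow]
  · simp [HasExactPeriod, sumCongr_zpow]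

/-! ### Involutions with prescribed values on a subset -/

/-- An embedding of `β` into an `n`-element set, extended by an enumeration of the complement. -/
theorem exists_sum_equiv_extending {β : Type*} [Fintype β] {n m : ℕ} (e : β ↪ Fin n)
    (hm : Fintype.card β + m = n) : ∃ ε : β ⊕ Fin m ≃ Fin n, ∀ b, ε (Sum.inl b) = e b := by
  classical
  have h : Fintype.card {x // x ∉ Set.range e} = m := by
    rw [Fintype.card_subtype_compl, Fintype.card_fin]
    have : Fintype.card {x // x ∈ Set.range e} = Fintype.card β :=
      (Fintype.card_congr (Equiv.ofInjective e e.injective)).symm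
    omega
  refine ⟨(Equiv.sumCongr (Equiv.ofInjective e e.injective)
    (Fintype.equivFinOfCardEq h).symm).trans (Equiv.sumCompl _), fun b => ?_⟩
  simp

/-- Involutions of the complement of the image of `e` correspond to involutions extending the
transport of `s` along `e`. -/
theorem exists_involution_equiv {β : Type*} [Finite β] {n m : ℕ} (ε : β ⊕ Fin m ≃ Fin n)
    (s : Perm β) (hs : s * s = 1) :
    ∃ Φ : Involution m ≃
        {σ : Involution n // ∀ b, σ.toPerm (ε (Sum.inl b)) = ε (Sum.inl (s b))},
      ∀ σ, (Φ σ).1.toPerm = ε.permCongr (Perm.sumCongr s σ.toPerm) := by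
  have hinv : ∀ σ : Involution m, ε.permCongr (Perm.sumCongr s σ.toPerm) *
      ε.permCongr (Perm.sumCongr s σ.toPerm) = 1 := by
    intro σ
    have h2 : σ.toPerm * σ.toPerm = 1 := σ.2
    have h3 : ε.permCongrHom (Perm.sumCongr s σ.toPerm) * ε.permCongrHom (Perm.sumCongr s σ.toPerm)
      = 1 := by
      rw [← map_mul, Perm.sumCongr_mul, hs, h2, Perm.sumCongr_one, map_one]
    exact h3
  let f : Involution m →
      {σ : Involution n // ∀ b, σ.toPerm (ε (Sum.inl b)) = ε (Sum.inl (s b))} := fun σ =>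
    ⟨⟨ε.permCongr (Perm.sumCongr s σ.toPerm), hinv σ⟩, fun b => by
      simp [Involution.toPerm, Equiv.permCongr_apply]⟩
  refine ⟨Equiv.ofBijective f ⟨fun σ σ' h => ?_, ?_⟩, fun σ => rfl⟩
  · have h1 : ε.permCongr (Perm.sumCongr s σ.toPerm) = ε.permCongr (Perm.sumCongr s σ'.toPerm) :=
      congrArg (fun x => x.1.toPerm) h
    have h2 := ε.permCongr.injective h1
    exact Subtype.ext (congrArg Prod.snd (Perm.sumCongrHom_injective (a₁ := (s, σ.toPerm))
      (a₂ := (s, σ'.toPerm)) h2))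
  · rintro ⟨⟨σ, hσ⟩, h⟩
    change ∀ b, σ (ε (Sum.inl b)) = ε (Sum.inl (s b)) at h
    have hm : Set.MapsTo (ε.symm.permCongr σ) (Set.range Sum.inl) (Set.range Sum.inl) := by
      rintro _ ⟨b, rfl⟩
      exact ⟨s b, by simp [Equiv.permCongr_apply, h]⟩
    -- A permutation of a finite sum that preserves the left summand also preserves the right one,
    -- hence splits.
    obtain ⟨⟨s', t⟩, hst⟩ := Perm.mem_sumCongrHom_range_of_perm_mapsTo_inl hm
    have hst' : σ = ε.permCongr (Perm.sumCongr s' t) := by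
      apply ε.symm.permCongr.injective
      rw [← hst]
      ext x
      simp [Equiv.permCongr_apply]
    have hs' : s' = s := by
      ext b
      have := h b
      rw [hst'] at this
      simpa [Equiv.permCongr_apply] using this
    subst hs'
    have ht : t * t = 1 := by
      have h3 : ε.permCongrHom (Perm.sumCongrHom _ _ (s' * s', t * t)) = 1 := by
        have : ε.permCongrHom (Perm.sumCongrHom _ _ (s', t)) = σ := hst'.symm
        rw [← Prod.mk_mul_mk, map_mul, map_mul, this, hσ]
      rw [map_eq_one_iff _ ε.permCongrHom.injective,
        map_eq_one_iff _ Perm.sumCongrHom_injective] at h3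
      exact congrArg Prod.snd h3
    exact ⟨⟨t, ht⟩, Subtype.ext (Subtype.ext hst'.symm)⟩

/-! ### Cycles of a product of involutions as dihedral orbits -/

theorem HasExactPeriod.zpow_eq_zpow_iff {α : Type*} {k : ℕ} {π : Perm α} {v : α}
    (h : HasExactPeriod k π v) (m m' : ℤ) : (π ^ m) v = (π ^ m') v ↔ (m : ZMod k) = m' := by
  rw [ZMod.intCast_eq_intCast_iff_dvd_sub, ← h, sub_eq_neg_add, zpow_add, zpow_neg, Perm.mul_apply,
    Perm.inv_eq_iff_eq, eq_comm]

/-- The parametrisation of a cycle of length `k` by `ZMod k`. -/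
def HasExactPeriod.orbitEmbedding {α : Type*} {k : ℕ} {π : Perm α} {v : α}
    (h : HasExactPeriod k π v) : ZMod k ↪ α where
  toFun i := (π ^ (i.cast : ℤ)) v
  inj' i j hij := by simpa using (h.zpow_eq_zpow_iff _ _).1 hij

theorem HasExactPeriod.orbitEmbedding_intCast {α : Type*} {k : ℕ} {π : Perm α} {v : α}
    (h : HasExactPeriod k π v) (m : ℤ) : h.orbitEmbedding (m : ZMod k) = (π ^ m) v :=
  (h.zpow_eq_zpow_iff _ _).2 (by simp)

theorem zpow_apply_of_apply_eq_add_one {α : Type*} {k : ℕ} {π : Perm α} {e : ZMod k → α}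
    (h : ∀ i, π (e i) = e (i + 1)) (m : ℤ) (i : ZMod k) : (π ^ m) (e i) = e (i + m) := by
  induction m with
  | zero => simp
  | succ m ih => rw [add_comm, zpow_add, Perm.mul_apply, ih, zpow_one, h]; push_cast; ring_nf
  | pred m ih =>
    rw [sub_eq_neg_add, zpow_add, Perm.mul_apply, ih, zpow_neg, zpow_one, Perm.inv_eq_iff_eq, h]
    push_cast
    ring_nf

theorem hasExactPeriod_of_apply_eq_add_one {α : Type*} {k : ℕ} {π : Perm α} {e : ZMod k ↪ α}
    (h : ∀ i, π (e i) = e (i + 1)) (i : ZMod k) : HasExactPeriod k π (e i) := by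
  intro m
  rw [zpow_apply_of_apply_eq_add_one h, e.injective.eq_iff, add_eq_left,
    ZMod.intCast_zmod_eq_zero_iff_dvd]

/-- This is the dihedral relation: conjugation by `σ` inverts `τ * σ` because both factors are
involutions. -/
theorem involution_zpow_mul {α : Type*} {σ τ : Perm α} (hσ : σ * σ = 1) (hτ : τ * τ = 1) (m : ℤ)
    (v : α) : σ (((τ * σ) ^ m) v) = ((τ * σ) ^ (-m)) (σ v) := by
  have h1 : σ * (τ * σ) * σ⁻¹ = (τ * σ)⁻¹ := by
    rw [mul_inv_rev, inv_eq_of_mul_eq_one_left hσ, inv_eq_of_mul_eq_one_left hτ, mul_assoc,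
      mul_assoc, hσ, mul_one]
  have h2 : σ * (τ * σ) ^ m * σ⁻¹ = (τ * σ) ^ (-m) := by
    rw [← conj_zpow, h1, inv_zpow, zpow_neg]
  rw [← h2]
  simp

/-- Points on a cycle of length `k` that is preserved by `σ` correspond to equivariant embeddings
of the action of a dihedral group on a `k`-gon. -/
theorem card_reflected_cycle_points {α : Type*} [Finite α] {k : ℕ} [NeZero k] {σ τ : Perm α}
    (hσ : σ * σ = 1) (hτ : τ * τ = 1) :
    Nat.card {v // HasExactPeriod k (τ * σ) v ∧ ∃ m : ℤ, σ v = ((τ * σ) ^ m) v} =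
      ∑ c : ZMod k, Nat.card {e : ZMod k ↪ α //
        (∀ i, σ (e i) = e (Equiv.subLeft c i)) ∧ ∀ i, τ (e i) = e (Equiv.subLeft (c + 1) i)} := by
  rw [← Nat.card_sigma]
  -- The two reflections compose to a rotation: `(c + 1) - (c - i) = i + 1`.
  have hstep : ∀ (c : ZMod k) (e : ZMod k ↪ α), (∀ i, σ (e i) = e (Equiv.subLeft c i)) →
      (∀ i, τ (e i) = e (Equiv.subLeft (c + 1) i)) → ∀ i, (τ * σ) (e i) = e (i + 1) := by
    intro c e h1 h2 i
    rw [Perm.mul_apply, h1, h2]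
    simp only [Equiv.subLeft_apply]
    ring_nf
  symm
  refine Nat.card_eq_of_bijective (fun x => ⟨x.2.1 0,
    hasExactPeriod_of_apply_eq_add_one (hstep x.1 x.2.1 x.2.2.1 x.2.2.2) 0, ?_⟩) ⟨?_, ?_⟩
  · obtain ⟨c, e, h1, h2⟩ := x
    obtain ⟨m, rfl⟩ := ZMod.intCast_surjective c
    exact ⟨m, by simp [zpow_apply_of_apply_eq_add_one (hstep _ e h1 h2), h1]⟩
  · rintro ⟨c, e, h1, h2⟩ ⟨c', e', h1', h2'⟩ h
    replace h : e 0 = e' 0 := congrArg Subtype.val h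
    have hee : e = e' := by
      ext i
      obtain ⟨m, rfl⟩ := ZMod.intCast_surjective i
      have h3 := zpow_apply_of_apply_eq_add_one (hstep _ e h1 h2) m 0
      have h4 := zpow_apply_of_apply_eq_add_one (hstep _ e' h1' h2') m 0
      rw [zero_add] at h3 h4
      rw [← h3, ← h4, h]
    subst hee
    -- The reflection is recovered from the embedding, since `σ (e 0) = e c`.
    have h5 := (h1 0).symm.trans (h1' 0)
    simp only [Equiv.subLeft_apply, sub_zero, e.injective.eq_iff] at h5
    subst h5
    rfl
  · rintro ⟨v, hv, m, hm⟩
    have h1 : ∀ i, σ (hv.orbitEmbedding i) =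
        hv.orbitEmbedding (Equiv.subLeft (m : ZMod k) i) := by
      intro i
      obtain ⟨j, rfl⟩ := ZMod.intCast_surjective i
      rw [hv.orbitEmbedding_intCast, involution_zpow_mul hσ hτ, hm, Equiv.subLeft_apply,
        ← Int.cast_sub, hv.orbitEmbedding_intCast, ← Perm.mul_apply, ← zpow_add, sub_eq_neg_add]
    have h2 : ∀ i, τ (hv.orbitEmbedding i) =
        hv.orbitEmbedding (Equiv.subLeft ((m : ZMod k) + 1) i) := by
      intro i
      have h3 : i = Equiv.subLeft (m : ZMod k) (Equiv.subLeft (m : ZMod k) i) := by simp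
      rw [h3, ← h1, ← Perm.mul_apply]
      obtain ⟨j, rfl⟩ := ZMod.intCast_surjective i
      rw [Equiv.subLeft_apply, ← Int.cast_sub, hv.orbitEmbedding_intCast, ← Perm.mul_apply,
        ← zpow_one_add, Equiv.subLeft_apply, Equiv.subLeft_apply, ← hv.orbitEmbedding_intCast]
      push_cast
      ring_nf
    refine ⟨⟨m, hv.orbitEmbedding, h1, h2⟩, Subtype.ext ?_⟩
    simpa using hv.orbitEmbedding_intCast 0

/-- The second generator of the regular action of a dihedral group, the first one being the
exchange of the two summands. -/
def dihedralSwap (k : ℕ) : Perm (ZMod k ⊕ ZMod k) :=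
  (Equiv.sumComm _ _).trans (Equiv.sumCongr (Equiv.addRight 1) (Equiv.subRight 1))

@[simp]
theorem dihedralSwap_inl {k : ℕ} (i : ZMod k) : dihedralSwap k (Sum.inl i) = Sum.inr (i - 1) := rfl

@[simp]
theorem dihedralSwap_inr {k : ℕ} (i : ZMod k) : dihedralSwap k (Sum.inr i) = Sum.inl (i + 1) := rfl

/-- Points on a cycle of length `k` that is moved by `σ` correspond to equivariant embeddings of the
regular action of a dihedral group. -/
theorem card_moved_cycle_points {α : Type*} [Finite α] {k : ℕ} {σ τ : Perm α}
    (hσ : σ * σ = 1) (hτ : τ * τ = 1) :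
    Nat.card {v // HasExactPeriod k (τ * σ) v ∧ ¬ ∃ m : ℤ, σ v = ((τ * σ) ^ m) v} =
      Nat.card {e : ZMod k ⊕ ZMod k ↪ α //
        (∀ i, σ (e i) = e (Equiv.sumComm _ _ i)) ∧ ∀ i, τ (e i) = e (dihedralSwap k i)} := by
  have hστ : ∀ v, τ (σ v) = (τ * σ) v := fun v => rfl
  have hσσ : ∀ v, σ (σ v) = v := fun v => by rw [← Perm.mul_apply, hσ, Perm.one_apply]
  have hstep : ∀ (e : ZMod k ⊕ ZMod k ↪ α), (∀ i, σ (e i) = e (Equiv.sumComm _ _ i)) →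
      (∀ i, τ (e i) = e (dihedralSwap k i)) →
      ∀ i, (τ * σ) (Function.Embedding.inl.trans e i) = Function.Embedding.inl.trans e (i + 1) := by
    intro e h1 h2 i
    simp [h1, h2]
  symm
  refine Nat.card_eq_of_bijective (fun x => ⟨Function.Embedding.inl.trans x.1 0,
    hasExactPeriod_of_apply_eq_add_one (hstep x.1 x.2.1 x.2.2) 0, ?_⟩) ⟨?_, ?_⟩
  · obtain ⟨e, h1, h2⟩ := x
    rintro ⟨m, hm⟩
    rw [zpow_apply_of_apply_eq_add_one (hstep e h1 h2)] at hm
    simp [h1] at hm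
  · rintro ⟨e, h1, h2⟩ ⟨e', h1', h2'⟩ h
    replace h : e (Sum.inl 0) = e' (Sum.inl 0) := congrArg Subtype.val h
    have hl : ∀ i, e (Sum.inl i) = e' (Sum.inl i) := by
      intro i
      obtain ⟨m, rfl⟩ := ZMod.intCast_surjective i
      have h3 := zpow_apply_of_apply_eq_add_one (hstep e h1 h2) m 0
      have h4 := zpow_apply_of_apply_eq_add_one (hstep e' h1' h2') m 0
      simp only [zero_add, Function.Embedding.trans_apply, Function.Embedding.inl_apply] at h3 h4
      rw [← h3, ← h4, h]
    refine Subtype.ext (Function.Embedding.ext fun x => ?_)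
    rcases x with i | i
    · exact hl i
    · have h3 := h1 (Sum.inl i)
      rw [hl, h1'] at h3
      exact h3.symm
  · rintro ⟨v, hv, hm⟩
    -- The left summand is the cycle of `v`, the right one its image under `σ`. If they met, `σ v`
    -- would lie on the cycle of `v`.
    let e : ZMod k ⊕ ZMod k ↪ α :=
      ⟨Sum.elim hv.orbitEmbedding (fun i => σ (hv.orbitEmbedding i)), by
        refine Function.Injective.sumElim hv.orbitEmbedding.injective
          (σ.injective.comp hv.orbitEmbedding.injective) fun i j hij => hm ?_
        obtain ⟨a, rfl⟩ := ZMod.intCast_surjective i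
        obtain ⟨b, rfl⟩ := ZMod.intCast_surjective j
        rw [hv.orbitEmbedding_intCast, hv.orbitEmbedding_intCast, involution_zpow_mul hσ hτ,
          zpow_neg, Perm.eq_inv_iff_eq, ← Perm.mul_apply, ← zpow_add] at hij
        exact ⟨_, hij.symm⟩⟩
    have hstep' : ∀ i, (τ * σ) (hv.orbitEmbedding i) = hv.orbitEmbedding (i + 1) := by
      intro i
      obtain ⟨j, rfl⟩ := ZMod.intCast_surjective i
      rw [hv.orbitEmbedding_intCast, ← Perm.mul_apply, ← zpow_one_add, ← hv.orbitEmbedding_intCast]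
      push_cast
      ring_nf
    have h1 : ∀ i, σ (e i) = e (Equiv.sumComm _ _ i) := by
      rintro (i | i)
      · rfl
      · exact hσσ _
    have h2 : ∀ i, τ (e i) = e (dihedralSwap k i) := by
      rintro (i | i)
      · have h3 := hstep' (i - 1)
        rw [sub_add_cancel] at h3
        change τ (hv.orbitEmbedding i) = σ (hv.orbitEmbedding (i - 1))
        rw [← h3, ← Perm.mul_apply, ← mul_assoc, hτ, one_mul]
      · exact hstep' i
    refine ⟨⟨e, h1, h2⟩, Subtype.ext ?_⟩
    change hv.orbitEmbedding 0 = v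
    simpa using hv.orbitEmbedding_intCast 0

theorem card_hasExactPeriod_mul {α : Type*} [Finite α] {k : ℕ} [NeZero k] {σ τ : Perm α}
    (hσ : σ * σ = 1) (hτ : τ * τ = 1) :
    Nat.card {v // HasExactPeriod k (τ * σ) v} =
      (∑ c : ZMod k, Nat.card {e : ZMod k ↪ α //
        (∀ i, σ (e i) = e (Equiv.subLeft c i)) ∧ ∀ i, τ (e i) = e (Equiv.subLeft (c + 1) i)}) +
      Nat.card {e : ZMod k ⊕ ZMod k ↪ α //
        (∀ i, σ (e i) = e (Equiv.sumComm _ _ i)) ∧ ∀ i, τ (e i) = e (dihedralSwap k i)} := by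
  classical
  rw [← card_reflected_cycle_points hσ hτ, ← card_moved_cycle_points hσ hτ, ← Nat.card_sum]
  refine Nat.card_congr ((Equiv.sumCompl
    (fun v : {v // HasExactPeriod k (τ * σ) v} => ∃ m : ℤ, σ v.1 = ((τ * σ) ^ m) v.1)).symm.trans ?_)
  exact Equiv.sumCongr 
    (Equiv.subtypeSubtypeEquivSubtypeInter _ (fun v => ∃ m : ℤ, σ v = ((τ * σ) ^ m) v))
    (Equiv.subtypeSubtypeEquivSubtypeInter _ (fun v => ¬ ∃ m : ℤ, σ v = ((τ * σ) ^ m) v))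

theorem card_hasExactPeriod_subLeft {k : ℕ} (c : ZMod k) :
    Nat.card {i // HasExactPeriod k (Equiv.subLeft (c + 1) * Equiv.subLeft c) i} = k := by
  have h : ∀ i, HasExactPeriod k (Equiv.subLeft (c + 1) * Equiv.subLeft c) i := fun i =>
    hasExactPeriod_of_apply_eq_add_one (e := Function.Embedding.refl _) (fun i => by
      simp only [Function.Embedding.refl_apply, Perm.mul_apply, Equiv.subLeft_apply]; ring) i
  rw [Nat.card_congr (Equiv.subtypeUnivEquiv h), Nat.card_zmod]

theorem card_hasExactPeriod_dihedralSwap (k : ℕ) [NeZero k] :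
    Nat.card {i // HasExactPeriod k (dihedralSwap k * Equiv.sumComm (ZMod k) (ZMod k)) i} =
      k * 2 := by
  have h : ∀ i, HasExactPeriod k (dihedralSwap k * Equiv.sumComm (ZMod k) (ZMod k)) i := by
    rintro (i | i)
    · exact hasExactPeriod_of_apply_eq_add_one (e := Function.Embedding.inl) (fun i => by simp) i
    -- On the right summand the product is `i ↦ i - 1`, so negation turns it into the standard
    -- rotation.
    · have := hasExactPeriod_of_apply_eq_add_one
        (π := dihedralSwap k * Equiv.sumComm (ZMod k) (ZMod k))
        (e := (Equiv.neg (ZMod k)).toEmbedding.trans Function.Embedding.inr)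
        (fun i => by simp [sub_eq_neg_add]) (-i)
      simpa using this
  rw [Nat.card_congr (Equiv.subtypeUnivEquiv h), Nat.card_sum, Nat.card_zmod, mul_two]

/-! ### The size-bias identity -/

/-- The number of `k`-cycles in the product of a pair of involutions. -/
def pairCycles (k : ℕ) {n : ℕ} (p : Involution n × Involution n) : ℕ :=
  numCycles k (p.2.toPerm * p.1.toPerm)

-- The image of `e` is a union of cycles contributing `j` cycles of length `k`; on the complement
-- the two involutions are unconstrained.
open Classical in
theorem sum_pairs_extending {R : Type*} [AddCommMonoid R] {β : Type*} [Fintype β] {k n m j : ℕ}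
    (hk : 1 ≤ k) (e : β ↪ Fin n) (hm : Fintype.card β + m = n) (s t : Perm β) (hs : s * s = 1)
    (ht : t * t = 1) (hj : Nat.card {b // HasExactPeriod k (t * s) b} = k * j) (ψ : ℕ → R) :
    ∑ p : Involution n × Involution n,
      (if (∀ b, p.1.toPerm (e b) = e (s b)) ∧ ∀ b, p.2.toPerm (e b) = e (t b) then
        ψ (pairCycles k p) else 0) =
      ∑ p : Involution m × Involution m, ψ (pairCycles k p + j) := by
  obtain ⟨ε, hε⟩ := exists_sum_equiv_extending e hm
  obtain ⟨Φ, hΦ⟩ := exists_involution_equiv ε s hs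
  obtain ⟨Ψ, hΨ⟩ := exists_involution_equiv ε t ht
  simp only [← hε]
  rw [← Finset.sum_filter]
  symm
  refine Finset.sum_bij (fun p _ => ((Φ p.1).1, (Ψ p.2).1)) ?_ ?_ ?_ ?_
  · intro p _
    simpa using ⟨(Φ p.1).2, (Ψ p.2).2⟩
  · rintro ⟨p1, p2⟩ _ ⟨q1, q2⟩ _ h
    simp only [Prod.mk.injEq] at h
    rw [Φ.injective (Subtype.ext h.1), Ψ.injective (Subtype.ext h.2)]
  · rintro ⟨q1, q2⟩ hq
    simp only [Finset.mem_filter, Finset.mem_univ, true_and] at hq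
    exact ⟨(Φ.symm ⟨q1, hq.1⟩, Ψ.symm ⟨q2, hq.2⟩), Finset.mem_univ _, by simp⟩
  · rintro ⟨p1, p2⟩ _
    congr 1
    apply Nat.eq_of_mul_eq_mul_left hk
    simp only [pairCycles, hΦ, hΨ]
    rw [mul_add, mul_numCycles hk, mul_numCycles hk, ← Equiv.permCongr_mul, Perm.sumCongr_mul,
      card_hasExactPeriod_permCongr_sumCongr, hj, add_comm]

/-- If `b > n` there are no embeddings and the descending factorial is `0`, so the truncated `n - b`
is harmless; the premise of `h` encodes `b ≤ n`. -/
theorem card_embedding_mul_eq {R : Type*} [Semiring R] {β : Type*} [Fintype β] {n b : ℕ}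
    (hb : Fintype.card β = b) (φ : (β ↪ Fin n) → R) (a : ℕ → R)
    (h : ∀ e, b + (n - b) = n → φ e = a (n - b)) :
    ∑ e, φ e = (n.descFactorial b : R) * a (n - b) := by
  classical
  subst hb
  rw [Finset.sum_congr rfl (g := fun _ => a (n - Fintype.card β)) fun e _ =>
    h e (Nat.add_sub_of_le (by simpa using Fintype.card_le_of_embedding e))]
  rw [Finset.sum_const, Finset.card_univ, Fintype.card_embedding_eq, Fintype.card_fin, nsmul_eq_mul]

/-- Size-bias identity for the number of `k`-cycles in the product of two involutions. -/
theorem sum_pairCycles_mul {R : Type*} [CommSemiring R] {k : ℕ} (hk : 1 ≤ k) (n : ℕ) (ψ : ℕ → R) :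
    ∑ p : Involution n × Involution n, ((k * pairCycles k p : ℕ) : R) * ψ (pairCycles k p) =
      k * (n.descFactorial k *
        ∑ p : Involution (n - k) × Involution (n - k), ψ (pairCycles k p + 1)) +
      n.descFactorial (2 * k) *
        ∑ p : Involution (n - 2 * k) × Involution (n - 2 * k), ψ (pairCycles k p + 2) := by
  classical
  have : NeZero k := ⟨by omega⟩
  have h1 : ∀ p : Involution n × Involution n,
      ((k * pairCycles k p : ℕ) : R) * ψ (pairCycles k p) =
      (∑ c : ZMod k, ∑ e : ZMod k ↪ Fin n,
        (if (∀ i, p.1.toPerm (e i) = e (Equiv.subLeft c i)) ∧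
          ∀ i, p.2.toPerm (e i) = e (Equiv.subLeft (c + 1) i) then ψ (pairCycles k p) else 0)) +
      ∑ e : ZMod k ⊕ ZMod k ↪ Fin n,
        (if (∀ i, p.1.toPerm (e i) = e (Equiv.sumComm _ _ i)) ∧
          ∀ i, p.2.toPerm (e i) = e (dihedralSwap k i) then ψ (pairCycles k p) else 0) := by
    intro p
    rw [pairCycles, mul_numCycles hk, card_hasExactPeriod_mul (σ := p.1.toPerm) (τ := p.2.toPerm) p.1.2 p.2.2]
    simp only [Nat.card_eq_fintype_card, Fintype.card_subtype, Nat.cast_add, Nat.cast_sum,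
      Finset.card_filter, Nat.cast_ite, Nat.cast_one, Nat.cast_zero, add_mul, Finset.sum_mul,
      ite_mul, one_mul, zero_mul]
  rw [Finset.sum_congr rfl fun p _ => h1 p, Finset.sum_add_distrib, Finset.sum_comm]
  congr 1
  · have hc : ∀ c : ZMod k, ∑ p : Involution n × Involution n, ∑ e : ZMod k ↪ Fin n,
        (if (∀ i, p.1.toPerm (e i) = e (Equiv.subLeft c i)) ∧
          ∀ i, p.2.toPerm (e i) = e (Equiv.subLeft (c + 1) i) then ψ (pairCycles k p) else 0) =
        n.descFactorial k *
          ∑ p : Involution (n - k) × Involution (n - k), ψ (pairCycles k p + 1) := by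
      intro c
      rw [Finset.sum_comm]
      exact card_embedding_mul_eq (n := n) (β := ZMod k) (R := R) (ZMod.card k) _
        (fun m => ∑ p : Involution m × Involution m, ψ (pairCycles k p + 1))
        (fun e he => sum_pairs_extending hk e (by rwa [ZMod.card]) (Equiv.subLeft c)
          (Equiv.subLeft (c + 1)) (by ext; simp) (by ext; simp)
          (by rw [card_hasExactPeriod_subLeft, mul_one]) ψ)
    rw [Finset.sum_congr rfl fun c _ => hc c, Finset.sum_const, Finset.card_univ, ZMod.card,
      nsmul_eq_mul]
  · rw [Finset.sum_comm]
    have hcard : Fintype.card (ZMod k ⊕ ZMod k) = 2 * k := by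
      rw [Fintype.card_sum, ZMod.card, two_mul]
    have hs : Equiv.sumComm (ZMod k) (ZMod k) * Equiv.sumComm (ZMod k) (ZMod k) = 1 := by
      ext x; simp
    have ht : dihedralSwap k * dihedralSwap k = 1 := by
      ext x; rcases x with x | x <;> simp
    exact card_embedding_mul_eq (n := n) (β := ZMod k ⊕ ZMod k) (R := R) hcard _
      (fun m => ∑ p : Involution m × Involution m, ψ (pairCycles k p + 2))
      (fun e he => sum_pairs_extending hk e (by rwa [hcard]) (Equiv.sumComm _ _)
        (dihedralSwap k) hs ht (card_hasExactPeriod_dihedralSwap k) ψ)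

/-! ### Growth of the number of involutions -/

theorem card_involution_extending {β : Type*} [Fintype β] {n m : ℕ} (e : β ↪ Fin n)
    (hm : Fintype.card β + m = n) (s : Perm β) (hs : s * s = 1) :
    Nat.card {σ : Involution n // ∀ b, σ.toPerm (e b) = e (s b)} =
      Fintype.card (Involution m) := by
  obtain ⟨ε, hε⟩ := exists_sum_equiv_extending e hm
  obtain ⟨Φ, -⟩ := exists_involution_equiv ε s hs
  simp only [← hε]
  rw [← Nat.card_congr Φ, Nat.card_eq_fintype_card]

/-- Classify by the image of `0`: either `0` is fixed, or it is paired with one of the `n + 1` other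
points. -/
theorem card_involution_add_two (n : ℕ) :
    Fintype.card (Involution (n + 2)) =
      Fintype.card (Involution (n + 1)) + (n + 1) * Fintype.card (Involution n) := by
  classical
  have h0 : Nat.card {σ : Involution (n + 2) // σ.toPerm 0 = 0} =
      Fintype.card (Involution (n + 1)) := by
    let e : Unit ↪ Fin (n + 2) := ⟨fun _ => 0, fun _ _ _ => rfl⟩
    rw [← card_involution_extending e (by rw [Fintype.card_unit]; omega) 1 (one_mul 1)]
    exact Nat.card_congr (Equiv.subtypeEquivRight fun σ => ⟨fun h _ => h, fun h => h ()⟩)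
  have h1 : ∀ j : Fin (n + 1), Nat.card {σ : Involution (n + 2) // σ.toPerm 0 = j.succ} =
      Fintype.card (Involution n) := by
    intro j
    let e : Bool ↪ Fin (n + 2) := ⟨fun b => cond b j.succ 0, by
      rintro (_ | _) (_ | _) h
      · rfl
      · exact absurd h (Fin.succ_ne_zero j).symm
      · exact absurd h (Fin.succ_ne_zero j)
      · rfl⟩
    rw [← card_involution_extending e (by rw [Fintype.card_bool]; omega) Equiv.boolNot
      (by ext b; simp)]
    refine Nat.card_congr (Equiv.subtypeEquivRight fun σ => ⟨fun h => ?_, fun h => h false⟩)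
    have hσ : ∀ v, σ.toPerm (σ.toPerm v) = v := fun v => by
      rw [← Perm.mul_apply]; exact congrArg (· v) σ.2
    rintro (_ | _)
    · exact h
    · change σ.toPerm j.succ = 0
      rw [← h, hσ]
  have h2 : Fintype.card (Involution (n + 2)) =
      ∑ j : Fin (n + 2), Nat.card {σ : Involution (n + 2) // σ.toPerm 0 = j} := by
    rw [← Nat.card_sigma, ← Nat.card_eq_fintype_card]
    exact Nat.card_congr (Equiv.sigmaFiberEquiv fun σ : Involution (n + 2) => σ.toPerm 0).symm
  rw [h2, Fin.sum_univ_succ, h0, Finset.sum_congr rfl fun j _ => h1 j]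
  simp

open Filter Topology
open scoped Nat

/-- The exponential weight `t ^ 2 / n!` of the set of pairs of involutions of `[n]`, where `t` is
the number of involutions. -/
noncomputable def pairWeight (n : ℕ) : ℝ := (Fintype.card (Involution n) : ℝ) ^ 2 / n !

theorem card_involution_pos (n : ℕ) : 0 < (Fintype.card (Involution n) : ℝ) := by
  exact_mod_cast Fintype.card_pos

theorem pairWeight_pos (n : ℕ) : 0 < pairWeight n := by
  have := card_involution_pos n
  unfold pairWeight
  positivity

theorem card_involution_of_le_one {n : ℕ} (hn : n ≤ 1) : Fintype.card (Involution n) = 1 := by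
  have : Subsingleton (Fin n) := Fin.subsingleton_iff_le_one.2 hn
  rw [Fintype.card_eq_one_iff]
  exact ⟨⟨1, one_mul 1⟩, fun σ => Subtype.ext (Equiv.ext fun _ => Subsingleton.elim _ _)⟩

/-- The ratio `r_n` of consecutive counts satisfies `r_{n+1} = 1 + (n+1)/r_n`, so each bound at `n`
yields the opposite bound at `n + 1`; they must be proved together. -/
theorem card_involution_succ_bounds (n : ℕ) :
    √(n + 1) * Fintype.card (Involution n) ≤ Fintype.card (Involution (n + 1)) ∧
      (Fintype.card (Involution (n + 1)) : ℝ) ≤ (√(n + 1) + 1) * Fintype.card (Involution n) := by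
  induction n with
  | zero => simp [card_involution_of_le_one]
  | succ n ih =>
    obtain ⟨h1, h2⟩ := ih
    have h0 := card_involution_pos n
    have h01 := card_involution_pos (n + 1)
    have hrec : (Fintype.card (Involution (n + 2)) : ℝ) =
        Fintype.card (Involution (n + 1)) + (n + 1) * Fintype.card (Involution n) := by
      exact_mod_cast card_involution_add_two n
    rw [show n + 1 + 1 = n + 2 from rfl, hrec]
    generalize (Fintype.card (Involution n) : ℝ) = x at *
    generalize (Fintype.card (Involution (n + 1)) : ℝ) = y at *
    push_cast
    set s := √((n : ℝ) + 1) with hs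
    have hs2 : s ^ 2 = n + 1 := Real.sq_sqrt (by positivity)
    have hs0 : 0 < s := Real.sqrt_pos.2 (by positivity)
    have hss : s ≤ √((n : ℝ) + 1 + 1) := Real.sqrt_le_sqrt (by linarith)
    rw [← hs2]
    constructor
    -- After squaring, the two sides differ by exactly `s ^ 2`.
    · have hr : √(s ^ 2 + 1) * (s + 1) ≤ s ^ 2 + s + 1 := by
        apply le_of_sq_le_sq _ (by positivity)
        rw [mul_pow, Real.sq_sqrt (by positivity)]
        nlinarith [sq_nonneg s]
      have hx : s ^ 2 * y ≤ (s + 1) * (s ^ 2 * x) := by nlinarith [sq_nonneg s]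
      refine le_of_mul_le_mul_left ?_ (by positivity : 0 < s + 1)
      calc (s + 1) * (√(s ^ 2 + 1) * y) = √(s ^ 2 + 1) * (s + 1) * y := by ring
        _ ≤ (s ^ 2 + s + 1) * y := by gcongr
        _ ≤ (s + 1) * (y + s ^ 2 * x) := by linarith
    · rw [hs2]
      have h3 : s ^ 2 * x ≤ s * y := by nlinarith
      nlinarith

theorem pairWeight_succ_bounds (n : ℕ) : pairWeight n ≤ pairWeight (n + 1) ∧
    pairWeight (n + 1) ≤ (1 + 1 / √(n + 1)) ^ 2 * pairWeight n := by
  obtain ⟨h1, h2⟩ := card_involution_succ_bounds n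
  have h0 := card_involution_pos n
  unfold pairWeight
  rw [Nat.factorial_succ]
  push_cast
  set s := √((n : ℝ) + 1) with hs
  have hs2 : (n : ℝ) + 1 = s ^ 2 := (Real.sq_sqrt (by positivity)).symm
  have hs0 : 0 < s := Real.sqrt_pos.2 (by positivity)
  rw [hs2]
  generalize (Fintype.card (Involution n) : ℝ) = x at *
  generalize (Fintype.card (Involution (n + 1)) : ℝ) = y at *
  have hy : 0 ≤ y := by nlinarith
  have hf : (0 : ℝ) < n ! := by positivity
  constructor
  · rw [div_le_div_iff₀ hf (by positivity)]
    calc x ^ 2 * (s ^ 2 * n !) = (s * x) ^ 2 * n ! := by ring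
      _ ≤ _ := by gcongr
  · rw [div_le_iff₀ (by positivity)]
    calc y ^ 2 ≤ ((s + 1) * x) ^ 2 := by gcongr
      _ = _ := by field_simp

theorem pairWeight_mono : Monotone pairWeight :=
  monotone_nat_of_le_succ fun n => (pairWeight_succ_bounds n).1

theorem tendsto_pairWeight_div_succ :
    Tendsto (fun n => pairWeight n / pairWeight (n + 1)) atTop (𝓝 1) := by
  have hlim : Tendsto (fun n : ℕ => (((1 : ℝ) + 1 / √(n + 1)) ^ 2)⁻¹) atTop (𝓝 1) := by
    have h1 : Tendsto (fun n : ℕ => √((n : ℝ) + 1)) atTop atTop :=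
      Real.tendsto_sqrt_atTop.comp
        (tendsto_atTop_add_const_right _ _ tendsto_natCast_atTop_atTop)
    have h2 : Tendsto (fun n : ℕ => 1 / √((n : ℝ) + 1)) atTop (𝓝 0) :=
      tendsto_const_nhds.div_atTop h1
    have h3 := ((h2.const_add 1).pow 2).inv₀ (by norm_num)
    simpa using h3
  refine tendsto_of_tendsto_of_tendsto_of_le_of_le hlim tendsto_const_nhds (fun n => ?_)
    fun n => ?_
  · have := (pairWeight_succ_bounds n).2
    dsimp only
    rw [inv_eq_one_div, div_le_div_iff₀ (by positivity) (pairWeight_pos _), one_mul, mul_comm]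
    exact this
  · exact div_le_one_of_le₀ (pairWeight_succ_bounds n).1 (pairWeight_pos _).le

theorem tendsto_pairWeight_div_add (j : ℕ) :
    Tendsto (fun n => pairWeight n / pairWeight (n + j)) atTop (𝓝 1) := by
  induction j with
  | zero => simp [div_self (pairWeight_pos _).ne']
  | succ j ih =>
    have h := ih.mul (tendsto_pairWeight_div_succ.comp (tendsto_add_atTop_nat j))
    rw [one_mul] at h
    refine h.congr fun n => ?_
    simp only [Function.comp_apply]
    rw [div_mul_div_cancel₀ (pairWeight_pos _).ne', add_assoc]

/-- The weight of pairs of involutions of `n - j` points, understood to be `0` if `n < j`. -/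
noncomputable def shiftedPairWeight (n j : ℕ) : ℝ := if j ≤ n then pairWeight (n - j) else 0

theorem tendsto_shiftedPairWeight_div (j : ℕ) :
    Tendsto (fun n => shiftedPairWeight n j / pairWeight n) atTop (𝓝 1) := by
  rw [← tendsto_add_atTop_iff_nat j]
  simpa [shiftedPairWeight] using tendsto_pairWeight_div_add j

theorem abs_shiftedPairWeight_div_le (n j : ℕ) :
    |shiftedPairWeight n j / pairWeight n| ≤ 1 := by
  have hn := pairWeight_pos n
  unfold shiftedPairWeight
  split_ifs
  · rw [abs_of_pos (div_pos (pairWeight_pos _) hn)]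
    exact div_le_one_of_le₀ (pairWeight_mono (Nat.sub_le _ _)) hn.le
  · simp

theorem shiftedPairWeight_add (n i j : ℕ) :
    shiftedPairWeight n (i + j) = if i ≤ n then shiftedPairWeight (n - i) j else 0 := by
  unfold shiftedPairWeight
  split_ifs <;> first | omega | rfl | rw [Nat.sub_add_eq]

/-! ### The generating polynomial and its expansion -/

/-- The generating polynomial of the number of `k`-cycles of products of pairs of involutions. -/
noncomputable def cyclePoly (k n : ℕ) (u : ℂ) : ℂ :=
  (∑ p : Involution n × Involution n, u ^ pairCycles k p) / n !

theorem cyclePoly_one (k n : ℕ) : cyclePoly k n 1 = pairWeight n := by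
  simp [cyclePoly, pairWeight, sq]

theorem descFactorial_div_factorial (n j : ℕ) :
    (n.descFactorial j : ℂ) / n ! = if j ≤ n then 1 / ((n - j)! : ℂ) else 0 := by
  split_ifs with h
  · rw [div_eq_div_iff (by exact_mod_cast n.factorial_ne_zero)
      (by exact_mod_cast (n - j).factorial_ne_zero), one_mul, mul_comm]
    exact_mod_cast Nat.factorial_mul_descFactorial h
  · rw [Nat.descFactorial_of_lt (not_le.1 h)]
    simp

/-- This is the size-bias identity for `ψ N = u ^ (N - 1)`. Division by `n!` absorbs the descending
factorials. -/
theorem hasDerivAt_cyclePoly {k : ℕ} (hk : 1 ≤ k) (n : ℕ) (u : ℂ) :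
    HasDerivAt (cyclePoly k n) ((if k ≤ n then cyclePoly k (n - k) u else 0) +
      u / k * (if 2 * k ≤ n then cyclePoly k (n - 2 * k) u else 0)) u := by
  have hk0 : (k : ℂ) ≠ 0 := by exact_mod_cast (by omega : k ≠ 0)
  have h1 : HasDerivAt (cyclePoly k n)
      ((∑ p : Involution n × Involution n, (pairCycles k p : ℂ) * u ^ (pairCycles k p - 1)) / n !)
      u := by
    unfold cyclePoly
    exact (HasDerivAt.fun_sum fun p _ => hasDerivAt_pow _ _).div_const _
  convert h1 using 1
  -- At `N = 0` the truncated exponent does not matter, because the factor `N` vanishes.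
  have h2 := sum_pairCycles_mul hk n (fun N => u ^ (N - 1))
  simp only [Nat.add_sub_cancel, show ∀ N, N + 2 - 1 = N + 1 from fun _ => rfl, Nat.cast_mul,
    mul_assoc, ← Finset.mul_sum] at h2
  have h3 : (∑ p : Involution n × Involution n, (pairCycles k p : ℂ) * u ^ (pairCycles k p - 1)) =
    n.descFactorial k *
        (∑ p : Involution (n - k) × Involution (n - k), u ^ (pairCycles k p)) + u / k *
      (n.descFactorial (2 * k) *
        ∑ p : Involution (n - 2 * k) × Involution (n - 2 * k), u ^ (pairCycles k p)) := by
    apply mul_left_cancel₀ hk0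
    rw [h2]
    simp only [_root_.pow_succ', ← Finset.mul_sum]
    field_simp
  have h4 : ∀ x y z w : ℂ, (x * y + u / k * (z * w)) / n ! =
      x / n ! * y + u / k * (z / n ! * w) := fun x y z w => by ring
  rw [h3, h4, descFactorial_div_factorial, descFactorial_div_factorial]
  unfold cyclePoly
  split_ifs <;> ring

theorem hasDerivAt_pow_div_factorial (a : ℕ) (z : ℂ) :
    HasDerivAt (fun z : ℂ => z ^ a / a !) (a * z ^ (a - 1) / a !) z :=
  (hasDerivAt_pow a z).div_const _

theorem succ_mul_pow_div_factorial (a : ℕ) (z : ℂ) :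
    ((a + 1 : ℕ) : ℂ) * z ^ (a + 1 - 1) / (a + 1)! = z ^ a / a ! := by
  have h1 : ((a + 1 : ℕ) : ℂ) ≠ 0 := by exact_mod_cast a.succ_ne_zero
  rw [Nat.factorial_succ, Nat.cast_mul, Nat.add_sub_cancel, mul_div_mul_left _ _ h1]

/-- A partial sum of the expansion of the generating polynomial. -/
noncomputable def cycleExpansion (k A B n : ℕ) (u : ℂ) : ℂ :=
  ∑ a ∈ Finset.range A, ∑ b ∈ Finset.range B,
    (u - 1) ^ a / a ! * (((u ^ 2 - 1) / (2 * k)) ^ b / b !) *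
      shiftedPairWeight n (k * a + 2 * k * b)

/-- The inner derivatives are `1` and `u / k`. Differentiating a divided power lowers its index,
which becomes a shift of the weight by `k` or `2 * k` and costs one unit of truncation. -/
theorem hasDerivAt_cycleExpansion {k : ℕ} (hk : 1 ≤ k) (A B n : ℕ) (u : ℂ) :
    HasDerivAt (cycleExpansion k (A + 1) (B + 1) n)
      ((if k ≤ n then cycleExpansion k A (B + 1) (n - k) u else 0) +
        u / k * (if 2 * k ≤ n then cycleExpansion k (A + 1) B (n - 2 * k) u else 0)) u := by
  have hk0 : (k : ℂ) ≠ 0 := by exact_mod_cast (by omega : k ≠ 0)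
  have hα : HasDerivAt (fun u : ℂ => u - 1) 1 u := (hasDerivAt_id u).sub_const 1
  have hβ : HasDerivAt (fun u : ℂ => (u ^ 2 - 1) / (2 * k)) (u / k) u := by
    convert! ((hasDerivAt_pow 2 u).sub_const 1).div_const (2 * (k : ℂ)) using 1
    field_simp
    simp [mul_comm]
  set α : ℂ := u - 1 with hαd
  set β : ℂ := (u ^ 2 - 1) / (2 * k) with hβd
  have h1 : HasDerivAt (cycleExpansion k (A + 1) (B + 1) n)
      (∑ a ∈ Finset.range (A + 1), ∑ b ∈ Finset.range (B + 1),
        (a * α ^ (a - 1) / a ! * (β ^ b / b !) +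
          α ^ a / a ! * (b * β ^ (b - 1) / b ! * (u / k))) *
        shiftedPairWeight n (k * a + 2 * k * b)) u := by
    unfold cycleExpansion
    refine HasDerivAt.fun_sum fun a _ => HasDerivAt.fun_sum fun b _ => HasDerivAt.mul_const ?_ _
    have := ((hasDerivAt_pow_div_factorial a α).comp u hα).mul
      ((hasDerivAt_pow_div_factorial b β).comp u hβ)
    rw [mul_one] at this
    exact this
  convert h1 using 1
  simp only [add_mul, Finset.sum_add_distrib]
  congr 1
  · rw [Finset.sum_range_succ']
    simp only [succ_mul_pow_div_factorial, Nat.cast_zero, zero_mul, zero_div, Finset.sum_const_zero,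
      add_zero]
    have hs : ∀ a b, shiftedPairWeight n (k * (a + 1) + 2 * k * b) =
        if k ≤ n then shiftedPairWeight (n - k) (k * a + 2 * k * b) else 0 := fun a b => by
      rw [← shiftedPairWeight_add]
      congr 1
      ring
    simp only [hs]
    split_ifs
    · rfl
    · simp
  · simp only [Finset.sum_range_succ' _ B]
    simp only [succ_mul_pow_div_factorial, Nat.cast_zero, zero_mul, zero_div, mul_zero, add_zero]
    have hs : ∀ a b, shiftedPairWeight n (k * a + 2 * k * (b + 1)) =
        if 2 * k ≤ n then shiftedPairWeight (n - 2 * k) (k * a + 2 * k * b) else 0 := fun a b => by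
      rw [← shiftedPairWeight_add]
      congr 1
      ring
    simp only [hs]
    split_ifs
    · unfold cycleExpansion
      simp only [Finset.mul_sum]
      refine Finset.sum_congr rfl fun a _ => Finset.sum_congr rfl fun b _ => ?_
      ring
    · simp

theorem cycleExpansion_one {k A B n : ℕ} (hA : 0 < A) (hB : 0 < B) :
    cycleExpansion k A B n 1 = pairWeight n := by
  obtain ⟨A, rfl⟩ := Nat.exists_eq_succ_of_ne_zero hA.ne'
  obtain ⟨B, rfl⟩ := Nat.exists_eq_succ_of_ne_zero hB.ne'
  simp [cycleExpansion, Finset.sum_range_succ', shiftedPairWeight]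

/-- By induction both sides have the same derivative, and both equal `pairWeight n` at `u = 1`. The
conditions `n < A` and `n < B` survive because each shift is at least `1`. -/
theorem cyclePoly_eq_cycleExpansion {k : ℕ} (hk : 1 ≤ k) (n A B : ℕ) (hA : n < A) (hB : n < B) :
    cyclePoly k n = cycleExpansion k A B n := by
  induction n using Nat.strong_induction_on generalizing A B with
  | _ n ih =>
    obtain ⟨A, rfl⟩ := Nat.exists_eq_succ_of_ne_zero (by omega : A ≠ 0)
    obtain ⟨B, rfl⟩ := Nat.exists_eq_succ_of_ne_zero (by omega : B ≠ 0)
    have h1 : ∀ u, HasDerivAt (fun u => cyclePoly k n u - cycleExpansion k (A + 1) (B + 1) n u)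
        0 u := by
      intro u
      refine ((hasDerivAt_cyclePoly hk n u).sub
        (hasDerivAt_cycleExpansion hk A B n u)).congr_deriv ?_
      have e1 : k ≤ n → cyclePoly k (n - k) = cycleExpansion k A (B + 1) (n - k) := fun h =>
        ih _ (by omega) _ _ (by omega) (by omega)
      have e2 : 2 * k ≤ n → cyclePoly k (n - 2 * k) = cycleExpansion k (A + 1) B (n - 2 * k) :=
        fun h => ih _ (by omega) _ _ (by omega) (by omega)
      split_ifs with h3 h4 h4
      · rw [e1 h3, e2 h4]; ring
      · rw [e1 h3]; ring
      · rw [e2 h4]; ring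
      · ring
    have h2 := is_const_of_deriv_eq_zero (fun u => (h1 u).differentiableAt) fun u => (h1 u).deriv
    ext u
    have h3 := h2 u 1
    rw [cyclePoly_one, cycleExpansion_one (by omega) (by omega), sub_self] at h3
    exact sub_eq_zero.1 h3

theorem tendsto_cyclePoly_div {k : ℕ} (hk : 1 ≤ k) (u : ℂ) :
    Tendsto (fun n => cyclePoly k n u / pairWeight n) atTop
      (𝓝 (Complex.exp (u - 1) * Complex.exp ((u ^ 2 - 1) / (2 * k)))) := by
  set α : ℂ := u - 1 with hαd
  set β : ℂ := (u ^ 2 - 1) / (2 * k) with hβd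
  have hexp : ∀ z : ℂ, HasSum (fun a : ℕ => z ^ a / a !) (Complex.exp z) := fun z => by
    rw [Complex.exp_eq_exp_ℂ]; exact NormedSpace.expSeries_div_hasSum_exp z
  have hnorm : ∀ z : ℂ, Summable (fun a : ℕ => ‖z ^ a / (a ! : ℂ)‖) := fun z =>
    NormedSpace.norm_expSeries_div_summable z
  have hsum : Summable fun x : ℕ × ℕ => ‖α ^ x.1 / x.1 ! * (β ^ x.2 / (x.2 ! : ℂ))‖ :=
    summable_mul_of_summable_norm (hnorm α) (hnorm β) |>.norm
  have hlim : ∑' x : ℕ × ℕ, α ^ x.1 / x.1 ! * (β ^ x.2 / x.2 !) =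
      Complex.exp α * Complex.exp β := by
    rw [← (hexp α).tsum_eq, ← (hexp β).tsum_eq, tsum_mul_tsum_of_summable_norm (hnorm α) (hnorm β)]
  rw [← hlim]
  -- Indices outside the finite box have weight `0`, so the sum may run over all pairs,
  -- independently of `n`.
  have hn : ∀ n, cyclePoly k n u / pairWeight n = ∑' x : ℕ × ℕ,
      α ^ x.1 / x.1 ! * (β ^ x.2 / x.2 !) *
        ((shiftedPairWeight n (k * x.1 + 2 * k * x.2) / pairWeight n : ℝ) : ℂ) := by
    intro n
    rw [tsum_eq_sum (s := Finset.range (n + 1) ×ˢ Finset.range (n + 1)),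
      cyclePoly_eq_cycleExpansion hk n (n + 1) (n + 1) (by omega) (by omega), Finset.sum_product,
      cycleExpansion, Finset.sum_div]
    · refine Finset.sum_congr rfl fun a _ => ?_
      rw [Finset.sum_div]
      refine Finset.sum_congr rfl fun b _ => ?_
      push_cast
      ring
    · rintro ⟨a, b⟩ hab
      have h : ¬ k * a + 2 * k * b ≤ n := by
        simp only [Finset.mem_product, Finset.mem_range, not_and_or, not_lt] at hab
        have h1 : a ≤ k * a := Nat.le_mul_of_pos_left _ hk
        have h2 : b ≤ 2 * k * b := Nat.le_mul_of_pos_left _ (by omega)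
        omega
      simp [shiftedPairWeight, h]
  simp only [hn]
  refine tendsto_tsum_of_dominated_convergence hsum (fun x => ?_) (Eventually.of_forall fun n x => ?_)
  · have h := (tendsto_shiftedPairWeight_div (k * x.1 + 2 * k * x.2)).ofReal.const_mul
      (α ^ x.1 / x.1 ! * (β ^ x.2 / x.2 ! : ℂ))
    simpa using h
  · rw [norm_mul, Complex.norm_real, Real.norm_eq_abs]
    exact mul_le_of_le_one_right (norm_nonneg _) (abs_shiftedPairWeight_div_le _ _)

/-! ### Characteristic functions and the limit law -/

open MeasureTheory ProbabilityTheory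

theorem charFun_map_natCast {S : Type*} [MeasurableSpace S] (Q : Measure S) {Y : S → ℕ}
    (hY : AEMeasurable (fun ω => (Y ω : ℝ)) Q) (t : ℝ) :
    charFun (Q.map fun ω => (Y ω : ℝ)) t = ∫ ω, Complex.exp (t * Complex.I) ^ Y ω ∂Q := by
  rw [charFun_apply_real, integral_map hY (by fun_prop)]
  refine integral_congr_ae (Eventually.of_forall fun ω => ?_)
  dsimp only
  rw [← Complex.exp_nat_mul]
  push_cast
  ring_nf

/-- Convergence in distribution of natural numbers can be checked on characteristic functions. -/
theorem tendstoInDistribution_nat_of_tendsto_integral_exp {Ω : ℕ → Type*}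
    [∀ n, MeasurableSpace (Ω n)] (P : ∀ n, Measure (Ω n)) [∀ n, IsProbabilityMeasure (P n)]
    {Ω' : Type*} [MeasurableSpace Ω'] (P' : Measure Ω') [IsProbabilityMeasure P']
    {X : ∀ n, Ω n → ℕ} {Z : Ω' → ℕ} (hX : ∀ n, AEMeasurable (X n) (P n)) (hZ : AEMeasurable Z P')
    (h : ∀ t : ℝ, Tendsto (fun n => ∫ ω, Complex.exp (t * Complex.I) ^ X n ω ∂P n) atTop
      (𝓝 (∫ ω, Complex.exp (t * Complex.I) ^ Z ω ∂P'))) :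
    TendstoInDistribution X atTop Z P P' := by
  have hc : Measurable (Nat.cast : ℕ → ℝ) := .of_discrete
  have hX' : ∀ n, AEMeasurable (fun ω => (X n ω : ℝ)) (P n) := fun n => hc.comp_aemeasurable (hX n)
  have hZ' : AEMeasurable (fun ω => (Z ω : ℝ)) P' := hc.comp_aemeasurable hZ
  have hreal : TendstoInDistribution (fun n ω => (X n ω : ℝ)) atTop (fun ω => (Z ω : ℝ)) P P' := by
    refine ⟨hX', hZ', ProbabilityMeasure.tendsto_iff_tendsto_charFun.2 fun t => ?_⟩
    simp only [ProbabilityMeasure.coe_mk]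
    rw [charFun_map_natCast P' hZ']
    simp only [charFun_map_natCast _ (hX' _)]
    exact h t
  refine ⟨hX, hZ, ProbabilityMeasure.tendsto_iff_forall_integral_tendsto.2 fun f => ?_⟩
  -- Tietze extension from the closed subset `ℕ` of `ℝ` transfers real weak convergence back to `ℕ`.
  obtain ⟨g, -, hg⟩ := f.exists_extension_norm_eq_of_isClosedEmbedding
    (e := (Nat.cast : ℕ → ℝ)) Nat.isClosedEmbedding_coe_real
  have hlim := ProbabilityMeasure.tendsto_iff_forall_integral_tendsto.1 hreal.tendsto g
  simp only [ProbabilityMeasure.coe_mk] at hlim ⊢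
  have hgm : ∀ μ : Measure ℝ, AEStronglyMeasurable g μ := fun μ =>
    g.continuous.aestronglyMeasurable
  rw [integral_map hZ' (hgm _)] at hlim
  simp only [integral_map (hX' _) (hgm _)] at hlim
  have hfm : ∀ μ : Measure ℕ, AEStronglyMeasurable f μ := fun μ =>
    f.continuous.aestronglyMeasurable
  rw [integral_map hZ (hfm _)]
  simp only [integral_map (hX _) (hfm _)]
  simp only [← hg]
  exact hlim

theorem integral_uniform_prod (n : ℕ) (F : Involution n × Involution n → ℂ) :
    ∫ p, F p ∂((Involution.uniform n).prod (Involution.uniform n)) =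
      (∑ p, F p) / (Fintype.card (Involution n) : ℂ) ^ 2 := by
  have : IsProbabilityMeasure (Involution.uniform n) := by
    unfold Involution.uniform; infer_instance
  rw [integral_fintype .of_finite, Finset.sum_div]
  refine Finset.sum_congr rfl fun p _ => ?_
  have h1 : ∀ σ : Involution n, (Involution.uniform n).real {σ} =
      (Fintype.card (Involution n) : ℝ)⁻¹ := fun σ => by
    rw [Measure.real, Involution.uniform,
      PMF.toMeasure_apply_singleton _ _ (measurableSet_singleton σ)]
    simp
  rw [← Prod.mk.eta (p := p), ← Set.singleton_prod_singleton, measureReal_prod_prod, h1, h1,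
    Complex.real_smul]
  push_cast
  rw [div_eq_inv_mul, sq, mul_inv]

theorem integral_pow_poisson {Ω : Type*} [MeasurableSpace Ω] {P : Measure Ω} {A : Ω → ℕ}
    {r : NNReal} (hA : HasLaw A (poissonMeasure r) P) (u : ℂ) :
    ∫ ω, u ^ A ω ∂P = Complex.exp (r * (u - 1)) := by
  have h := hA.integral_comp (f := fun n : ℕ => u ^ n) Measurable.of_discrete.aestronglyMeasurable
  have h1 : ∫ ω, u ^ A ω ∂P = ∫ n, u ^ n ∂poissonMeasure r := h
  have hsum := (NormedSpace.expSeries_div_hasSum_exp ((r : ℂ) * u)).tsum_eq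
  rw [← Complex.exp_eq_exp_ℂ] at hsum
  rw [h1, integral_poissonMeasure, mul_sub, mul_one, sub_eq_neg_add, Complex.exp_add, ← hsum,
    ← tsum_mul_left]
  refine tsum_congr fun n => ?_
  rw [Complex.real_smul]
  push_cast
  rw [mul_pow]
  ring

theorem mainTheorem2 (k : ℕ) (hk : 1 ≤ k)
    -- for every `n`, two independent uniform involutions `σ n`, `τ n` of `[n]`
    {Ω : ℕ → Type*} [∀ n, MeasurableSpace (Ω n)]
    (P : ∀ n, MeasureTheory.Measure (Ω n)) [∀ n, MeasureTheory.IsProbabilityMeasure (P n)]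
    (σ τ : ∀ n, Ω n → Involution n)
    (hσ : ∀ n, ProbabilityTheory.HasLaw (σ n) (Involution.uniform n) (P n))
    (hτ : ∀ n, ProbabilityTheory.HasLaw (τ n) (Involution.uniform n) (P n))
    (hστ : ∀ n, ProbabilityTheory.IndepFun (σ n) (τ n) (P n))
    -- independent Poisson variables `A` of mean `1` and `B` of mean `1 / (2k)`
    {Ω' : Type*} [MeasurableSpace Ω']
    (P' : MeasureTheory.Measure Ω') [MeasureTheory.IsProbabilityMeasure P']
    (A B : Ω' → ℕ)
    (hA : ProbabilityTheory.HasLaw A (ProbabilityTheory.poissonMeasure 1) P')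
    (hB : ProbabilityTheory.HasLaw B
      (ProbabilityTheory.poissonMeasure (1 / (2 * (k : NNReal)))) P')
    (hAB : ProbabilityTheory.IndepFun A B P') :
    MeasureTheory.TendstoInDistribution
      (fun n ω => numCycles k ((τ n ω).toPerm * (σ n ω).toPerm)) Filter.atTop
      (fun ω => A ω + 2 * B ω) P P' := by
  have hlaw : ∀ n, HasLaw (fun ω => (σ n ω, τ n ω))
      ((Involution.uniform n).prod (Involution.uniform n)) (P n) := fun n => by
    have : IsProbabilityMeasure (Involution.uniform n) := by
      unfold Involution.uniform; infer_instance
    exact (hστ n).hasLaw_prod (hσ n) (hτ n)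
  refine tendstoInDistribution_nat_of_tendsto_integral_exp P P' (fun n => ?_) ?_ fun t => ?_
  · have hm : Measurable (fun p : Involution n × Involution n => pairCycles k p) := .of_discrete
    have h := hm.comp_aemeasurable (hlaw n).aemeasurable
    simpa only [Function.comp_def, pairCycles] using h
  · exact hA.aemeasurable.add (hB.aemeasurable.const_mul 2)
  · set u := Complex.exp (t * Complex.I)
    have h1 : ∀ n, ∫ ω, u ^ numCycles k ((τ n ω).toPerm * (σ n ω).toPerm) ∂P n =
        cyclePoly k n u / pairWeight n := fun n => by
      have h2 := (hlaw n).integral_comp (f := fun p => u ^ pairCycles k p)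
        Measurable.of_discrete.aestronglyMeasurable
      rw [integral_uniform_prod] at h2
      have h3 : (n ! : ℂ) ≠ 0 := by exact_mod_cast n.factorial_ne_zero
      rw [cyclePoly, pairWeight]
      push_cast
      rw [div_div_div_cancel_right₀ h3]
      exact h2
    have h4 : ∫ ω, u ^ (A ω + 2 * B ω) ∂P' =
        Complex.exp (u - 1) * Complex.exp ((u ^ 2 - 1) / (2 * k)) := by
      -- Independence factors the mean of `u ^ A * (u ^ 2) ^ B`; the Poisson formula is then used at
      -- `u` and at `u ^ 2`.
      have h5 := (hAB.comp (.of_discrete : Measurable fun a : ℕ => u ^ a)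
        (.of_discrete : Measurable fun b : ℕ => (u ^ 2) ^ b)).integral_fun_mul_eq_mul_integral
        (Measurable.of_discrete.comp_aemeasurable hA.aemeasurable).aestronglyMeasurable
        (Measurable.of_discrete.comp_aemeasurable hB.aemeasurable).aestronglyMeasurable
      simp only [Function.comp_apply] at h5
      simp only [pow_add, pow_mul]
      rw [h5, integral_pow_poisson hA, integral_pow_poisson hB]
      push_cast
      rw [one_mul, one_div_mul_eq_div]
    rw [h4]
    simp only [h1]
    exact tendsto_cyclePoly_div hk u
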